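/- Let $u_1,\dots,u_4\in\mathbb{R}^2$ be pairwise distinct and let $v_1,\dots,v_4\in\mathbb{R}^2$ be pairwise distinct. Write $\hat x=(x_1,x_2,1)^\top$ for $x\in\mathbb{R}^2$, and let $U=[\hat u_1\ \hat u_2\ \hat u_3\ \hat u_4]$ and $V=[\hat v_1\ \hat v_2\ \hat v_3\ \hat v_4]$ be the $3\times 4$ matrices of homogenized points. If $\operatorname{rank} U=\operatorname{rank} V$, then the four point pairs $(u_i,v_i)$ have a chiral reconstruction. Here a camera is a real $3\times4$ matrix $A=[G\ \ t]$ (with $G\in\mathbb{R}^{3\times3}$, $t\in\mathbb{R}^3$) of rank $3$, up to scaling; its center is the point $c_A\in\mathbb{P}^3_{\mathbb{R}}$ with $Ac_A=0$; it is finite if the last coordinate of $c_A$ is nonzero, equivalently $\det G\neq 0$; and its principal ray is $n_A=\det(G)\,A_{3,\bullet}^\top$, where $A_{3,\bullet}$ is the third row of $A$. Put $n_\infty=(0,0,0,1)^\top$. A chiral reconstruction of the pairs $(u_i,v_i)$ consists of two finite cameras $A_1,A_2$ with distinct centers and of points $q_i\in\mathbb{P}^3_{\mathbb{R}}$ such that,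 for every $i$, $A_1q_i=w_{1i}\hat u_i$ and $A_2q_i=w_{2i}\hat v_i$ with nonzero real scalars $w_{1i},w_{2i}$, and $$(n_\infty^\top q_i)(n_{A_1}^\top q_i)\ge 0,\qquad (n_\infty^\top q_i)(n_{A_2}^\top q_i)\ge 0,\qquad (n_{A_1}^\top q_i)(n_{A_2}^\top q_i)\ge 0 .$$ -/

import Mathlib

open scoped Matrix

noncomputable section

namespace TwoViewChirality

/-- Homogeneous representative `(x, y, 1)` of a point `(x, y)` of the affine image plane. -/
def homogenize (x : Fin 2 → ℝ) : Fin 3 → ℝ := ![x 0, x 1, 1]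

/-- The `3 × k` matrix whose columns are the homogenized image points. -/
def pointMatrix {k : ℕ} (u : Fin k → Fin 2 → ℝ) : Matrix (Fin 3) (Fin k) ℝ :=
  Matrix.of fun r i => homogenize (u i) r

/-- A (representative of a) projective camera: a real `3 × 4` matrix of rank three. -/
def IsCamera (A : Matrix (Fin 3) (Fin 4) ℝ) : Prop := A.rank = 3

/-- The block `G` of a camera `A = [G t]`. -/
def leftBlock (A : Matrix (Fin 3) (Fin 4) ℝ) : Matrix (Fin 3) (Fin 3) ℝ :=
  A.submatrix id Fin.castSucc

/-- The Cramer's rule representative of the camera center: up to alternating signs, its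
coordinates are the `3 × 3` minors of `A`; the last coordinate is `det G`. -/
def center (A : Matrix (Fin 3) (Fin 4) ℝ) : Fin 4 → ℝ :=
  fun i => (-1) ^ ((i : ℕ) + 1) * (A.submatrix id i.succAbove).det

/-- Normal vector of the oriented hyperplane at infinity. -/
def nInfty : Fin 4 → ℝ := ![0, 0, 0, 1]

/-- A camera is finite when its center does not lie on the hyperplane at infinity. -/
def IsFiniteCamera (A : Matrix (Fin 3) (Fin 4) ℝ) : Prop :=
  IsCamera A ∧ nInfty ⬝ᵥ center A ≠ 0

/-- The centers are distinct points of projective space. -/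
def NonCoincident (A₁ A₂ : Matrix (Fin 3) (Fin 4) ℝ) : Prop :=
  ¬ ∃ c : ℝ, c ≠ 0 ∧ center A₁ = c • center A₂

/-- The principal ray `det(G) • (third row of A)` of `A = [G t]`. -/
def principalRay (A : Matrix (Fin 3) (Fin 4) ℝ) : Fin 4 → ℝ :=
  (leftBlock A).det • A 2

/-- `(A₁, A₂, q)` is a projective reconstruction of the point pairs `(u i, v i)`. World points and
cameras are given by nonzero representatives; no condition depends on their scaling. -/
structure IsProjectiveReconstruction {k : ℕ} (u v : Fin k → Fin 2 → ℝ)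
    (A₁ A₂ : Matrix (Fin 3) (Fin 4) ℝ) (q : Fin k → Fin 4 → ℝ) : Prop where
  camera₁ : IsCamera A₁
  camera₂ : IsCamera A₂
  world_ne_zero : ∀ i, q i ≠ 0
  image₁ : ∀ i, ∃ w : ℝ, w ≠ 0 ∧ A₁ *ᵥ q i = w • homogenize (u i)
  image₂ : ∀ i, ∃ w : ℝ, w ≠ 0 ∧ A₂ *ᵥ q i = w • homogenize (v i)

/-- A chiral reconstruction: a projective reconstruction with finite non-coincident cameras all of
whose world points lie in the chiral domain of the two cameras. -/
structure IsChiralReconstruction {k : ℕ} (u v : Fin k → Fin 2 → ℝ)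
    (A₁ A₂ : Matrix (Fin 3) (Fin 4) ℝ) (q : Fin k → Fin 4 → ℝ) : Prop where
  reconstruction : IsProjectiveReconstruction u v A₁ A₂ q
  finite₁ : IsFiniteCamera A₁
  finite₂ : IsFiniteCamera A₂
  nonCoincident : NonCoincident A₁ A₂
  chiral₁ : ∀ i, 0 ≤ (nInfty ⬝ᵥ q i) * (principalRay A₁ ⬝ᵥ q i)
  chiral₂ : ∀ i, 0 ≤ (nInfty ⬝ᵥ q i) * (principalRay A₂ ⬝ᵥ q i)
  chiral₁₂ : ∀ i, 0 ≤ (principalRay A₁ ⬝ᵥ q i) * (principalRay A₂ ⬝ᵥ q i)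

/-- The point pairs `(u i, v i)` admit a chiral reconstruction. -/
def HasChiralReconstruction {k : ℕ} (u v : Fin k → Fin 2 → ℝ) : Prop :=
  ∃ (A₁ A₂ : Matrix (Fin 3) (Fin 4) ℝ) (q : Fin k → Fin 4 → ℝ),
    IsChiralReconstruction u v A₁ A₂ q

/-- The Cramer's rule vector is annihilated by the camera. -/
theorem mulVec_center (A : Matrix (Fin 3) (Fin 4) ℝ) : A *ᵥ center A = 0 := by
  have e : ∀ i : Fin 4, center A i = (-1) ^ ((i : ℕ) + 1) *
      (A.submatrix id i.succAbove).det := fun _ => rfl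
  have h : ∀ r, (A *ᵥ center A) r = A r 0 * center A 0 + A r 1 * center A 1 +
      A r 2 * center A 2 + A r 3 * center A 3 := by
    intro r
    simp only [Matrix.mulVec, dotProduct, Fin.sum_univ_four]
  ext r
  rw [h, e, e, e, e]
  simp only [Matrix.det_fin_three, Matrix.submatrix_apply, id]
  rw [show (0 : Fin 4).succAbove 0 = 1 from rfl, show (0 : Fin 4).succAbove 1 = 2 from rfl,
    show (0 : Fin 4).succAbove 2 = 3 from rfl, show (1 : Fin 4).succAbove 0 = 0 from rfl,
    show (1 : Fin 4).succAbove 1 = 2 from rfl, show (1 : Fin 4).succAbove 2 = 3 from rfl,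
    show (2 : Fin 4).succAbove 0 = 0 from rfl, show (2 : Fin 4).succAbove 1 = 1 from rfl,
    show (2 : Fin 4).succAbove 2 = 3 from rfl, show (3 : Fin 4).succAbove 0 = 0 from rfl,
    show (3 : Fin 4).succAbove 1 = 1 from rfl, show (3 : Fin 4).succAbove 2 = 2 from rfl,
    show ((0 : Fin 4) : ℕ) = 0 from rfl, show ((1 : Fin 4) : ℕ) = 1 from rfl,
    show ((2 : Fin 4) : ℕ) = 2 from rfl, show ((3 : Fin 4) : ℕ) = 3 from rfl]
  simp only [Pi.zero_apply]
  fin_cases r <;> dsimp only [Fin.mk_zero, Fin.mk_one, Fin.reduceFinMk, Fin.zero_eta] <;> ring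

/-- The last coordinate of the Cramer's rule center is `det G`. -/
theorem nInfty_dotProduct_center (A : Matrix (Fin 3) (Fin 4) ℝ) :
    nInfty ⬝ᵥ center A = (leftBlock A).det := by
  have e : center A 3 = (-1) ^ 4 * (leftBlock A).det := by
    have f : (Fin.succAbove 3 : Fin 3 → Fin 4) = Fin.castSucc := by decide
    rw [leftBlock, ← f]
    rfl
  have h : nInfty ⬝ᵥ center A =
      0 * center A 0 + 0 * center A 1 + 0 * center A 2 + 1 * center A 3 := by
    simp only [dotProduct, Fin.sum_univ_four]
    rfl
  rw [h, e]
  ring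

end TwoViewChirality

end

open scoped Matrix

noncomputable section

namespace TwoViewChirality

/-! Equal rank yields nonzero linear forms α, β and a constant c with α(v_i) = β(u_i) + c
(`exists_common_affine_function`). Pick an affine map x ↦ Lx + w with det L > 0 and α(Lx + w) = β(x)
+ c. Then v_i - (L u_i + w) lies in ker α, a line spanned by some d, and translating w along d makes
every coefficient s_i positive. The cameras [I 0] and `affineShiftCamera L w d` with q_i = (u_i, 1,
s_i) then work: the three factors in the chirality conditions are s_i, 1 and det L, all positive
(`hasChiralReconstruction_of_affine_shift`). -/

/-- A nonzero vector annihilated by `M` on the left forces `M` to have deficient row rank. -/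
theorem rank_lt_of_vecMul_eq_zero {k : ℕ} {M : Matrix (Fin 3) (Fin k) ℝ} {x : Fin 3 → ℝ}
    (hx : x ≠ 0) (h : x ᵥ* M = 0) : M.rank < 3 := by
  by_contra! hr
  have hle : M.rank ≤ 3 := by simpa using M.rank_le_card_height
  have hli : LinearIndependent ℝ M.row := by
    rw [linearIndependent_iff_card_eq_finrank_span, Set.finrank, ← M.rank_eq_finrank_span_row]
    simp [le_antisymm hle hr]
  refine hx (Matrix.vecMul_injective_iff.mpr hli ?_)
  simpa using h

/-- A matrix of deficient row rank is annihilated on the left by a nonzero vector. -/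
theorem exists_vecMul_eq_zero_of_rank_lt {k : ℕ} {M : Matrix (Fin 3) (Fin k) ℝ}
    (h : M.rank < 3) : ∃ x : Fin 3 → ℝ, x ≠ 0 ∧ x ᵥ* M = 0 := by
  by_contra! hx
  have hli : LinearIndependent ℝ M.row := by
    rw [← Matrix.vecMul_injective_iff]
    intro x y hxy
    by_contra hne
    exact hx (x - y) (sub_ne_zero.mpr hne) (by simpa [Matrix.sub_vecMul, sub_eq_zero] using hxy)
  rw [hli.rank_matrix] at h
  simp at h

theorem vecMul_pointMatrix_apply {k : ℕ} (x : Fin 3 → ℝ) (u : Fin k → Fin 2 → ℝ) (i : Fin k) :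
    (x ᵥ* pointMatrix u) i = x 0 * u i 0 + x 1 * u i 1 + x 2 := by
  simp [Matrix.vecMul, dotProduct, Fin.sum_univ_three, pointMatrix, homogenize]

/-- The homogenized points have deficient rank exactly when the points lie on an affine line. -/
theorem rank_pointMatrix_lt_iff {k : ℕ} [NeZero k] (u : Fin k → Fin 2 → ℝ) :
    (pointMatrix u).rank < 3 ↔
      ∃ a₀ a₁ c : ℝ, (a₀ ≠ 0 ∨ a₁ ≠ 0) ∧ ∀ i, a₀ * u i 0 + a₁ * u i 1 = c := by
  constructor
  · intro h
    obtain ⟨x, hx, h0⟩ := exists_vecMul_eq_zero_of_rank_lt h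
    have hi : ∀ i, x 0 * u i 0 + x 1 * u i 1 + x 2 = 0 := fun i => by
      rw [← vecMul_pointMatrix_apply, h0, Pi.zero_apply]
    refine ⟨x 0, x 1, -x 2, ?_, fun i => by linarith [hi i]⟩
    by_contra! hc
    have h2 := hi 0
    rw [hc.1, hc.2] at h2
    refine hx (funext fun j => ?_)
    fin_cases j
    · exact hc.1
    · exact hc.2
    · simpa using h2
  · rintro ⟨a₀, a₁, c, ha, h⟩
    refine rank_lt_of_vecMul_eq_zero (x := ![a₀, a₁, -c]) ?_ (funext fun i => ?_)
    · intro h0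
      have h0₀ := congrFun h0 0
      have h0₁ := congrFun h0 1
      simp at h0₀ h0₁
      tauto
    · rw [vecMul_pointMatrix_apply]
      simp [h i]

/-- Four point pairs of equal rank admit a common affine function that is nonconstant on each of
the two image planes. -/
theorem exists_common_affine_function (u v : Fin 4 → Fin 2 → ℝ)
    (hrank : (pointMatrix u).rank = (pointMatrix v).rank) :
    ∃ a₀ a₁ b₀ b₁ c : ℝ, (a₀ ≠ 0 ∨ a₁ ≠ 0) ∧ (b₀ ≠ 0 ∨ b₁ ≠ 0) ∧
      ∀ i, a₀ * v i 0 + a₁ * v i 1 = b₀ * u i 0 + b₁ * u i 1 + c := by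
  -- If both quadruples are collinear, each has a form constant on it.
  by_cases hlt : (pointMatrix u).rank < 3
  · obtain ⟨b₀, b₁, c, hb, hbu⟩ := (rank_pointMatrix_lt_iff u).mp hlt
    obtain ⟨a₀, a₁, c', ha, hav⟩ := (rank_pointMatrix_lt_iff v).mp (hrank ▸ hlt)
    exact ⟨a₀, a₁, b₀, b₁, c' - c, ha, hb, fun i => by rw [hav i, hbu i]; ring⟩
  -- Four homogeneous equations in the five unknowns (a₀, a₁, b₀, b₁, c) have a nonzero solution.
  let N : Matrix (Fin 4) (Fin 5) ℝ := Matrix.of fun i => ![v i 0, v i 1, -u i 0, -u i 1, -1]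
  obtain ⟨x, hxker, hx⟩ : ∃ x ∈ LinearMap.ker N.mulVecLin, x ≠ 0 :=
    Submodule.exists_mem_ne_zero_of_ne_bot
      (LinearMap.ker_ne_bot_of_finrank_lt (f := N.mulVecLin) (by simp))
  have hi : ∀ i, x 0 * v i 0 + x 1 * v i 1 = x 2 * u i 0 + x 3 * u i 1 + x 4 := fun i => by
    have := congrFun (LinearMap.mem_ker.mp hxker) i
    simp [N, Matrix.mulVec, dotProduct, Fin.sum_univ_five] at this
    linarith
  refine ⟨x 0, x 1, x 2, x 3, x 4, ?_, ?_, hi⟩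
  -- If one form vanishes, the relation either makes the other quadruple collinear, against rank 3,
  -- or forces x = 0.
  · by_contra! ha
    by_cases hb : x 2 ≠ 0 ∨ x 3 ≠ 0
    · refine hlt ((rank_pointMatrix_lt_iff u).mpr ⟨x 2, x 3, -x 4, hb, fun i => ?_⟩)
      have := hi i
      rw [ha.1, ha.2] at this
      linarith
    · push Not at hb
      have h4 := hi 0
      rw [ha.1, ha.2, hb.1, hb.2] at h4
      refine hx (funext fun j => ?_)
      fin_cases j
      exacts [ha.1, ha.2, hb.1, hb.2, by simpa using h4.symm]
  · by_contra! hb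
    by_cases ha : x 0 ≠ 0 ∨ x 1 ≠ 0
    · refine hlt (hrank ▸ (rank_pointMatrix_lt_iff v).mpr ⟨x 0, x 1, x 4, ha, fun i => ?_⟩)
      rw [hi i, hb.1, hb.2]
      ring
    · push Not at ha
      have h4 := hi 0
      rw [ha.1, ha.2, hb.1, hb.2] at h4
      refine hx (funext fun j => ?_)
      fin_cases j
      exacts [ha.1, ha.2, hb.1, hb.2, by simpa using h4.symm]

/-- A `3 × 4` matrix with invertible left block is a finite camera. -/
theorem isFiniteCamera_of_det_ne_zero {A : Matrix (Fin 3) (Fin 4) ℝ}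
    (h : (leftBlock A).det ≠ 0) : IsFiniteCamera A := by
  refine ⟨le_antisymm (by simpa using A.rank_le_card_height) ?_, ?_⟩
  · have hG : leftBlock A = A * (1 : Matrix (Fin 4) (Fin 4) ℝ).submatrix id Fin.castSucc := by
      rw [leftBlock]
      nth_rw 1 [← Matrix.mul_one A]
      rw [Matrix.submatrix_mul A 1 id id Fin.castSucc Function.bijective_id, Matrix.submatrix_id_id]
    have hr : (leftBlock A).rank = 3 := by
      simpa using Matrix.rank_of_isUnit _ ((Matrix.isUnit_iff_isUnit_det _).mpr h.isUnit)
    calc 3 = (leftBlock A).rank := hr.symm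
      _ ≤ A.rank := hG ▸ Matrix.rank_mul_le_left _ _
  · rwa [nInfty_dotProduct_center]

/-- The camera `[I 0]`. -/
def standardCamera : Matrix (Fin 3) (Fin 4) ℝ := !![1, 0, 0, 0; 0, 1, 0, 0; 0, 0, 1, 0]

/-- The camera with third row `(0, 0, 1, 0)` whose left block is the affine map `x ↦ L x + w` of the
image plane and whose last column is the direction `d`. -/
def affineShiftCamera (L : Matrix (Fin 2) (Fin 2) ℝ) (w d : Fin 2 → ℝ) :
    Matrix (Fin 3) (Fin 4) ℝ :=
  !![L 0 0, L 0 1, w 0, d 0; L 1 0, L 1 1, w 1, d 1; 0, 0, 1, 0]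

theorem det_leftBlock_standardCamera : (leftBlock standardCamera).det = 1 := by
  simp [leftBlock, standardCamera, Matrix.det_fin_three]

theorem det_leftBlock_affineShiftCamera (L : Matrix (Fin 2) (Fin 2) ℝ) (w d : Fin 2 → ℝ) :
    (leftBlock (affineShiftCamera L w d)).det = L.det := by
  simp [leftBlock, affineShiftCamera, Matrix.det_fin_three, Matrix.det_fin_two]

theorem nonCoincident_standardCamera_affineShiftCamera (L : Matrix (Fin 2) (Fin 2) ℝ)
    (w : Fin 2 → ℝ) {d : Fin 2 → ℝ} (hd : d ≠ 0) :
    NonCoincident standardCamera (affineShiftCamera L w d) := by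
  rintro ⟨c, -, hc⟩
  have h1 := mulVec_center standardCamera
  have hlast := nInfty_dotProduct_center standardCamera
  -- The first center is (0, 0, 0, 1), which the second camera sends to d ≠ 0.
  have h2 : affineShiftCamera L w d *ᵥ center standardCamera = 0 := by
    rw [hc, Matrix.mulVec_smul, mulVec_center, smul_zero]
  rw [det_leftBlock_standardCamera] at hlast
  generalize center standardCamera = e at h1 h2 hlast
  have e0 : e 0 = 0 := by
    simpa [standardCamera, Matrix.mulVec, dotProduct, Fin.sum_univ_four] using congrFun h1 0
  have e1 : e 1 = 0 := by
    simpa [standardCamera, Matrix.mulVec, dotProduct, Fin.sum_univ_four] using congrFun h1 1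
  have e2 : e 2 = 0 := by
    simpa [standardCamera, Matrix.mulVec, dotProduct, Fin.sum_univ_four] using congrFun h1 2
  have e3 : e 3 = 1 := by
    simpa [nInfty, dotProduct, Fin.sum_univ_four] using hlast
  refine hd (funext fun j => ?_)
  fin_cases j
  · simpa [affineShiftCamera, Matrix.mulVec, dotProduct, Fin.sum_univ_four, e0, e1, e2, e3]
      using congrFun h2 0
  · simpa [affineShiftCamera, Matrix.mulVec, dotProduct, Fin.sum_univ_four, e0, e1, e2, e3]
      using congrFun h2 1

/-- If an orientation-preserving affine map carries each `u i` to `v i` up to a positive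
displacement along a fixed direction, then the pairs have a chiral reconstruction. -/
theorem hasChiralReconstruction_of_affine_shift {k : ℕ} (u v : Fin k → Fin 2 → ℝ)
    (L : Matrix (Fin 2) (Fin 2) ℝ) (w d : Fin 2 → ℝ) (s : Fin k → ℝ) (hL : 0 < L.det) (hd : d ≠ 0)
    (hs : ∀ i, 0 < s i) (h : ∀ i, v i = L *ᵥ u i + w + s i • d) :
    HasChiralReconstruction u v := by
  have hfin₁ : IsFiniteCamera standardCamera :=
    isFiniteCamera_of_det_ne_zero (by rw [det_leftBlock_standardCamera]; exact one_ne_zero)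
  have hfin₂ : IsFiniteCamera (affineShiftCamera L w d) :=
    isFiniteCamera_of_det_ne_zero (by rw [det_leftBlock_affineShiftCamera]; exact hL.ne')
  let q : Fin k → Fin 4 → ℝ := fun i => ![u i 0, u i 1, 1, s i]
  have hinf : ∀ i, nInfty ⬝ᵥ q i = s i := fun i => by
    simp [nInfty, q, dotProduct, Fin.sum_univ_four]
  have hray₁ : ∀ i, principalRay standardCamera ⬝ᵥ q i = 1 := fun i => by
    rw [principalRay, det_leftBlock_standardCamera]
    simp [standardCamera, q, dotProduct, Fin.sum_univ_four]
  have hray₂ : ∀ i, principalRay (affineShiftCamera L w d) ⬝ᵥ q i = L.det := fun i => by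
    rw [principalRay, det_leftBlock_affineShiftCamera]
    simp [affineShiftCamera, q, dotProduct, Fin.sum_univ_four]
  refine ⟨standardCamera, affineShiftCamera L w d, q, ⟨hfin₁.1, hfin₂.1, fun i hi => ?_,
    fun i => ⟨1, one_ne_zero, ?_⟩, fun i => ⟨1, one_ne_zero, ?_⟩⟩, hfin₁, hfin₂,
    nonCoincident_standardCamera_affineShiftCamera L w hd, fun i => ?_, fun i => ?_, fun i => ?_⟩
  · simpa [q] using congrFun hi 2
  · ext j
    fin_cases j <;>
      simp [standardCamera, q, homogenize, Matrix.mulVec, dotProduct, Fin.sum_univ_four]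
  · ext j
    rw [homogenize, h i]
    fin_cases j <;>
      simp [affineShiftCamera, q, Matrix.mulVec, dotProduct, Fin.sum_univ_four, mul_comm,
        Matrix.vecHead, Matrix.vecTail]
  · rw [hinf, hray₁]
    exact mul_nonneg (hs i).le zero_le_one
  · rw [hinf, hray₂]
    exact mul_nonneg (hs i).le hL.le
  · rw [hray₁, hray₂]
    exact mul_nonneg zero_le_one hL.le

end TwoViewChirality

end

open TwoViewChirality in
theorem mainTheorem1 (u v : Fin 4 → Fin 2 → ℝ)
    (hu : Function.Injective u) (hv : Function.Injective v)
    (hrank : (TwoViewChirality.pointMatrix u).rank = (TwoViewChirality.pointMatrix v).rank) :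
    TwoViewChirality.HasChiralReconstruction u v := by
  obtain ⟨a₀, a₁, b₀, b₁, c, ha, hb, h⟩ := exists_common_affine_function u v hrank
  have hsq : ∀ x y : ℝ, x ≠ 0 ∨ y ≠ 0 → 0 < x ^ 2 + y ^ 2 := by
    rintro x y (hx | hy) <;> positivity
  have hA := hsq a₀ a₁ ha
  have hB := hsq b₀ b₁ hb
  set r := a₀ ^ 2 + a₁ ^ 2 with hr
  -- With d = (-a₁, a₀) and b' = (-b₁, b₀), L is a bᵀ / r + d b'ᵀ and w is c a / r + K d. Thus f i
  -- is the d-component of v i - L (u i), and any K below all f i makes the displacements positive.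
  let f : Fin 4 → ℝ := fun i => (a₀ * v i 1 - a₁ * v i 0) / r - (b₀ * u i 1 - b₁ * u i 0)
  obtain ⟨K, hK⟩ : ∃ K, ∀ i, K < f i := by
    obtain ⟨m, hm⟩ := (Set.finite_range f).bddBelow
    exact ⟨m - 1, fun i => by linarith [hm (Set.mem_range_self i)]⟩
  refine hasChiralReconstruction_of_affine_shift u v
    !![b₀ * a₀ / r + b₁ * a₁, b₁ * a₀ / r - b₀ * a₁; b₀ * a₁ / r - b₁ * a₀, b₁ * a₁ / r + b₀ * a₀]
    ![c * a₀ / r - K * a₁, c * a₁ / r + K * a₀] ![-a₁, a₀] (fun i => f i - K) ?_ ?_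
    (fun i => sub_pos.mpr (hK i)) (fun i => ?_)
  -- L factors as [a/r, d] times the matrix with rows b, b', of determinants 1 and b₀² + b₁².
  · rw [Matrix.det_fin_two_of]
    convert hB using 1
    field_simp
    rw [hr]
    ring
  · intro h0
    have h0₀ := congrFun h0 0
    have h0₁ := congrFun h0 1
    simp at h0₀ h0₁
    tauto
  · have hi := h i
    ext j
    fin_cases j
    · simp [f, dotProduct, Fin.sum_univ_two]
      field_simp
      rw [hr]
      linear_combination a₀ * hi
    · simp [f, dotProduct, Fin.sum_univ_two]
      field_simp
      rw [hr]
      linear_combination a₁ * hi
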